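/- Let $n\ge 0$, let $w=(q_0,\dots,q_n)$ be a tuple of positive integers and put $q=q_0q_1\cdots q_n$. For a field $F$ let $$\mathbb{WP}_w^n(F)=(F^{n+1}\setminus\{0\})/F^\times ,\qquad \lambda\star(x_0,\dots,x_n)=(\lambda^{q_0}x_0,\dots,\lambda^{q_n}x_n),$$ and write $[x_0:\dots:x_n]$ for the class of $(x_0,\dots,x_n)$. Let $K$ be a number field with algebraic closure $\overline{\mathbb Q}$. For $\mathfrak p=[x_0:\dots:x_n]\in\mathbb{WP}_w^n(K)$ the weighted height is $$\mathfrak{wh}_K(\mathfrak p)=\prod_{v\in M_K}\max_{0\le i\le n}|x_i|_v^{\,n_v/q_i},$$ where $M_K$ is the set of places of $K$, $n_v=[K_v:\mathbb Q_v]$ is the local degree, and $|\cdot|_v$ extends the standard absolute value of $\mathbb Q$. It does not depend on the choice of coordinates. A field of definition of a point $\mathfrak p\in\mathbb{WP}_w^n(\overline{\mathbb Q})$ is a field $$\mathbb Q(\mathfrak p)=\mathbb Q\left(\left(\frac{x_0}{x_i}\right)^{q_0/q},\dots,1,\dots,\left(\frac{x_n}{x_i}\right)^{q_n/q}\right)\subset\overline{\mathbb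 Q},$$ where $(x_0,\dots,x_n)$ are coordinates of $\mathfrak p$, $x_i\ne0$, the entry $1$ stands in position $i$, and $a^{m/q}$ denotes some $r\in\overline{\mathbb Q}$ with $r^q=a^m$. Since this field depends on these choices, $\mathbb Q(\mathfrak p)\subset K$ means that the inclusion holds for at least one choice. Then, for every real constant $c_0$, the set $$\{\mathfrak p\in\mathbb{WP}_w^n(K):\ \mathbb Q(\mathfrak p)\subset K\ \text{ and }\ \mathfrak{wh}_K(\mathfrak p)\le c_0\}$$ contains only finitely many points of $\mathbb{WP}_w^n(\overline{\mathbb Q})$; that is, its image under the natural map $\mathbb{WP}_w^n(K)\to\mathbb{WP}_w^n(\overline{\mathbb Q})$, $[x_0:\dots:x_n]\mapsto[x_0:\dots:x_n]$, is finite. -/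

import Mathlib

open NumberField

/-! ### Weighted projective spaces -/

namespace WeightedProj

/-- The weighted action `t ⋆ x = (t ^ w₀ x₀, …, t ^ wₙ xₙ)` on affine space. -/
def star {F : Type*} [Field F] {n : ℕ} (w : Fin (n + 1) → ℕ+) (t : Fˣ) (x : Fin (n + 1) → F) :
    Fin (n + 1) → F :=
  fun i => (t : F) ^ (w i : ℕ) * x i

theorem star_ne_zero {F : Type*} [Field F] {n : ℕ} (w : Fin (n + 1) → ℕ+) (t : Fˣ)
    {x : Fin (n + 1) → F} (hx : x ≠ 0) : star w t x ≠ 0 := by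
  obtain ⟨i, hi⟩ := Function.ne_iff.mp hx
  exact Function.ne_iff.mpr ⟨i, by simpa [star] using hi⟩

/-- Two nonzero tuples are equivalent when they lie in one orbit of the weighted action of `Fˣ`. -/
def orbitSetoid (F : Type*) [Field F] {n : ℕ} (w : Fin (n + 1) → ℕ+) :
    Setoid {x : Fin (n + 1) → F // x ≠ 0} where
  r x y := ∃ t : Fˣ, star w t y.1 = x.1
  iseqv :=
    { refl := fun x => ⟨1, by funext i; simp [star]⟩
      symm := by
        rintro x y ⟨t, h⟩
        refine ⟨t⁻¹, ?_⟩
        rw [← h]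
        funext i
        simp [star]
      trans := by
        rintro x y z ⟨t, h⟩ ⟨s, h'⟩
        refine ⟨t * s, ?_⟩
        rw [← h, ← h']
        funext i
        simp [star, mul_pow, mul_assoc] }

/-- The weighted projective space `WP_w^n(F) = (F^{n+1} ∖ {0}) / Fˣ`. -/
def WPSpace (F : Type*) [Field F] {n : ℕ} (w : Fin (n + 1) → ℕ+) : Type _ :=
  Quotient (orbitSetoid F w)

/-- The point `[x₀ : … : xₙ]`. -/
def WPSpace.mk {F : Type*} [Field F] {n : ℕ} (w : Fin (n + 1) → ℕ+) (x : Fin (n + 1) → F)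
    (hx : x ≠ 0) : WPSpace F w :=
  Quotient.mk (orbitSetoid F w) ⟨x, hx⟩

/-- For an extension `L / F`, the map `WP_w^n(F) → WP_w^n(L)`, `[x₀ : … : xₙ] ↦ [x₀ : … : xₙ]`. -/
def WPSpace.baseChange {F : Type*} [Field F] (L : Type*) [Field L] [Algebra F L] {n : ℕ}
    {w : Fin (n + 1) → ℕ+} : WPSpace F w → WPSpace L w :=
  Quotient.map' (s₁ := orbitSetoid F w) (s₂ := orbitSetoid L w)
    (fun x => ⟨fun i => algebraMap F L (x.1 i), by
      obtain ⟨i, hi⟩ := Function.ne_iff.mp x.2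
      exact Function.ne_iff.mpr ⟨i, by simpa using hi⟩⟩)
    (by
      rintro x y ⟨t, h⟩
      refine ⟨Units.map (algebraMap F L).toMonoidHom t, ?_⟩
      funext i
      simp [← h, star])

/-! ### The weighted height -/

section Height

variable {K : Type*} [Field K] [NumberField K] {n : ℕ}

/-- `∏_v max_i |x_i|_v ^ (n_v / w_i)` over all places `v` of `K`, with `n_v` the local degree.
At an infinite place, `n_v = v.mult`. At a finite place, Mathlib's `v x` is the normalized absolute
value `N(𝔭)^(-ord_𝔭 x)`, which is already `|x|_v ^ n_v`. -/
noncomputable def heightOfTuple (w : Fin (n + 1) → ℕ+) (x : Fin (n + 1) → K) : ℝ :=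
  (∏ v : InfinitePlace K, ⨆ i, v (x i) ^ ((v.mult : ℝ) / (w i : ℝ))) *
    ∏ᶠ v : FinitePlace K, ⨆ i, v (x i) ^ ((1 : ℝ) / (w i : ℝ))

/-- Almost all local factors at the finite places are `1`, so the product over them is a genuine
finite product. -/
theorem hasFiniteMulSupport_localFactor (w : Fin (n + 1) → ℕ+) {x : Fin (n + 1) → K} (hx : x ≠ 0) :
    (fun v : FinitePlace K => ⨆ i, v (x i) ^ ((1 : ℝ) / (w i : ℝ))).HasFiniteMulSupport := by
  have hne : ∀ i, ((1 : ℝ) / (w i : ℝ)) ≠ 0 := fun i => by simp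
  obtain ⟨i₀, hi₀⟩ := Function.ne_iff.mp hx
  have hfin : (⋃ i : {i // x i ≠ 0},
      (fun v : FinitePlace K => v (x i)).mulSupport).Finite :=
    Set.finite_iUnion fun i => FinitePlace.hasFiniteMulSupport i.2
  refine hfin.subset fun v hv => ?_
  by_contra hcon
  simp only [Set.mem_iUnion, Function.mem_mulSupport, not_exists, not_not, Subtype.forall] at hcon
  refine hv (le_antisymm (ciSup_le fun i => ?_) ?_)
  · by_cases hi : x i = 0
    · simp [hi, Real.zero_rpow]
    · rw [hcon i hi, Real.one_rpow]
  · refine Finite.le_ciSup_of_le i₀ ?_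
    rw [hcon i₀ hi₀, Real.one_rpow]

/-- The height of a tuple is constant on orbits. -/
theorem heightOfTuple_star (w : Fin (n + 1) → ℕ+) (t : Kˣ) {x : Fin (n + 1) → K} (hx : x ≠ 0) :
    heightOfTuple w (star w t x) = heightOfTuple w x := by
  have key : ∀ (a : ℝ) (b : Fin (n + 1) → ℝ) (m : ℕ), 0 ≤ a → (∀ i, 0 ≤ b i) →
      ⨆ i, (a ^ (w i : ℕ) * b i) ^ ((m : ℝ) / (w i : ℝ)) =
        a ^ m * ⨆ i, b i ^ ((m : ℝ) / (w i : ℝ)) := by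
    intro a b m ha hb
    rw [Real.mul_iSup_of_nonneg (pow_nonneg ha m)]
    congr 1
    funext i
    have hw : ((w i : ℕ) : ℝ) ≠ 0 := by simp
    rw [Real.mul_rpow (pow_nonneg ha _) (hb i), ← Real.rpow_natCast a (w i), ← Real.rpow_mul ha,
      mul_div_cancel₀ _ hw, Real.rpow_natCast]
  have h₁ : ∀ v : InfinitePlace K,
      ⨆ i, v (star w t x i) ^ ((v.mult : ℝ) / (w i : ℝ)) =
        v (t : K) ^ v.mult * ⨆ i, v (x i) ^ ((v.mult : ℝ) / (w i : ℝ)) := fun v => by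
    simpa [star] using key (v t) (fun i => v (x i)) v.mult (apply_nonneg v _)
      (fun i => apply_nonneg v _)
  have h₂ : ∀ v : FinitePlace K,
      ⨆ i, v (star w t x i) ^ ((1 : ℝ) / (w i : ℝ)) =
        v (t : K) * ⨆ i, v (x i) ^ ((1 : ℝ) / (w i : ℝ)) := fun v => by
    simpa [star] using key (v t) (fun i => v (x i)) 1 (apply_nonneg v _)
      (fun i => apply_nonneg v _)
  unfold heightOfTuple
  simp_rw [h₁, h₂]
  rw [Finset.prod_mul_distrib, finprod_mul_distrib (FinitePlace.hasFiniteMulSupport t.ne_zero)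
    (hasFiniteMulSupport_localFactor w hx), mul_mul_mul_comm, prod_abs_eq_one t.ne_zero, one_mul]

/-- The weighted multiplicative height `wh_K` on `WP_w^n(K)`. -/
noncomputable def weightedHeight {w : Fin (n + 1) → ℕ+} (p : WPSpace K w) : ℝ :=
  Quotient.liftOn p (fun x => heightOfTuple w x.1) (by
    rintro x y ⟨t, h⟩
    show heightOfTuple w x.1 = heightOfTuple w y.1
    rw [← h, heightOfTuple_star w t y.2])

end Height

/-! ### The field of definition -/

/-- `M` is a field of definition `ℚ((x₀/xᵢ)^(w₀/q), …, 1, …, (xₙ/xᵢ)^(wₙ/q))`, `q = w₀ ⋯ wₙ`, of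
the point `p`. This expression depends on the coordinates `x` of `p`, on the index `i` with
`xᵢ ≠ 0`, and on the values of the fractional powers (`r = a^(m/q)` means `r^q = a^m`); all of
the resulting fields are admitted. -/
def IsFieldOfDefinition {Ω : Type*} [Field Ω] [Algebra ℚ Ω] {n : ℕ} {w : Fin (n + 1) → ℕ+}
    (p : WPSpace Ω w) (M : IntermediateField ℚ Ω) : Prop :=
  ∃ (x : Fin (n + 1) → Ω) (hx : x ≠ 0) (i : Fin (n + 1)) (r : Fin (n + 1) → Ω),
    p = WPSpace.mk w x hx ∧ x i ≠ 0 ∧ r i = 1 ∧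
      (∀ j, r j ^ (∏ k, (w k : ℕ)) = (x j / x i) ^ (w j : ℕ)) ∧
      M = IntermediateField.adjoin ℚ (Set.range r)

end WeightedProj

/-!
The coordinatewise powers `x_j ↦ x_j ^ (q / w_j)`, with `q = w₀ ⋯ wₙ`, turn the weighted action
of `t` into multiplication of all coordinates by `t ^ q`, so they induce a map from the weighted
projective space to the ordinary projective space `ℙⁿ`.  The usual height of the image is the
`q`-th power of the weighted height (`heightOfTuple_pow_prod`).  Hence, by the Northcott property
of a number field, points of bounded weighted height have only finitely many images in `ℙⁿ(K)`,
or, in affine terms, only finitely many ratios `x_j ^ (q / w_j) / x_i ^ (q / w_i)` occur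
(`mulHeight₁_div_le_heightOfTuple_pow`).

Over an algebraically closed field the map to `ℙⁿ` has finite fibres: a point with `x_i ≠ 0` can be
rescaled so that its `i`-th coordinate is `1`, and then the power `q / w_j` of its `j`-th coordinate
is one of the ratios above (`exists_mk_eq_mk_pow_complWeight`, `finite_setOf_mk_pow_mem`).  So the
`K`-rational points of bounded weighted height have a finite image
(`finite_image_baseChange_setOf_weightedHeight_le`).
-/

namespace WeightedProj

/-- The exponent `q / w_j`, where `q = w₀ ⋯ wₙ`, written as the product of the other weights. -/
def complWeight {n : ℕ} (w : Fin (n + 1) → ℕ+) (j : Fin (n + 1)) : ℕ :=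
  ∏ k ∈ Finset.univ.erase j, (w k : ℕ)

theorem mul_complWeight {n : ℕ} (w : Fin (n + 1) → ℕ+) (j : Fin (n + 1)) :
    (w j : ℕ) * complWeight w j = ∏ k, (w k : ℕ) :=
  Finset.mul_prod_erase _ (fun k => (w k : ℕ)) (Finset.mem_univ j)

theorem complWeight_ne_zero {n : ℕ} (w : Fin (n + 1) → ℕ+) (j : Fin (n + 1)) :
    complWeight w j ≠ 0 :=
  Finset.prod_ne_zero_iff.mpr fun k _ => (w k).ne_zero

theorem iSup_rpow_div_pow_prod {n : ℕ} (w : Fin (n + 1) → ℕ+) {b : Fin (n + 1) → ℝ}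
    (hb : ∀ i, 0 ≤ b i) (k : ℕ) :
    (⨆ i, b i ^ ((k : ℝ) / (w i : ℝ))) ^ (∏ j, (w j : ℕ)) =
      (⨆ i, b i ^ complWeight w i) ^ k := by
  rw [Real.iSup_pow (fun i => Real.rpow_nonneg (hb i) _),
    Real.iSup_pow (fun i => pow_nonneg (hb i) _)]
  congr 1
  funext i
  have hw : ((w i : ℕ) : ℝ) ≠ 0 := by simp
  rw [← mul_complWeight w i, ← Real.rpow_natCast, ← Real.rpow_mul (hb i), ← pow_mul,
    ← Real.rpow_natCast (b i)]
  congr 1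
  push_cast
  field_simp

section Height

variable {K : Type*} [Field K] [NumberField K] {n : ℕ}

theorem heightOfTuple_pow_prod (w : Fin (n + 1) → ℕ+) {x : Fin (n + 1) → K} (hx : x ≠ 0) :
    heightOfTuple w x ^ (∏ j, (w j : ℕ)) =
      Height.mulHeight (fun i => x i ^ complWeight w i) := by
  have hx' : (fun i => x i ^ complWeight w i) ≠ 0 := by
    obtain ⟨i, hi⟩ := Function.ne_iff.mp hx
    exact Function.ne_iff.mpr ⟨i, pow_ne_zero _ hi⟩
  rw [NumberField.mulHeight_eq hx', heightOfTuple, mul_pow, ← Finset.prod_pow,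
    finprod_pow (hasFiniteMulSupport_localFactor w hx)]
  congr 1
  · refine Finset.prod_congr rfl fun v _ => ?_
    simpa using iSup_rpow_div_pow_prod w (fun i => apply_nonneg v (x i)) v.mult
  · refine finprod_congr fun v => ?_
    simpa using iSup_rpow_div_pow_prod w (fun i => apply_nonneg v (x i)) 1

theorem heightOfTuple_nonneg (w : Fin (n + 1) → ℕ+) (x : Fin (n + 1) → K) :
    0 ≤ heightOfTuple w x :=
  mul_nonneg
    (Finset.prod_nonneg fun v _ => Real.iSup_nonneg fun _ => Real.rpow_nonneg (apply_nonneg v _) _)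
    (finprod_nonneg fun v => Real.iSup_nonneg fun _ => Real.rpow_nonneg (apply_nonneg v _) _)

theorem mulHeight₁_div_le_heightOfTuple_pow (w : Fin (n + 1) → ℕ+) {x : Fin (n + 1) → K}
    (hx : x ≠ 0) (i j : Fin (n + 1)) :
    Height.mulHeight₁ (x j ^ complWeight w j / x i ^ complWeight w i) ≤
      heightOfTuple w x ^ (∏ k, (w k : ℕ)) := by
  rw [heightOfTuple_pow_prod w hx, Height.mulHeight₁_div_eq_mulHeight]
  refine le_of_eq_of_le (congrArg _ ?_)
    (Height.mulHeight_comp_le ![j, i] fun k => x k ^ complWeight w k)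
  funext k
  fin_cases k <;> rfl

end Height

theorem finite_setOf_pow_mem {L : Type*} [Field L] {m : ℕ} (hm : m ≠ 0) {S : Set L}
    (hS : S.Finite) : {u : L | u ^ m ∈ S}.Finite := by
  classical
  refine hS.preimage' fun a _ => ?_
  refine (Polynomial.nthRootsFinset m a).finite_toSet.subset fun u hu => ?_
  simpa [Polynomial.mem_nthRootsFinset (Nat.pos_of_ne_zero hm)] using hu

theorem finite_setOf_mk_pow_mem {L : Type*} [Field L] {n : ℕ} (w : Fin (n + 1) → ℕ+)
    {m : Fin (n + 1) → ℕ} (hm : ∀ j, m j ≠ 0) {S : Set L} (hS : S.Finite) :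
    {P : WPSpace L w | ∃ (u : Fin (n + 1) → L) (hu : u ≠ 0),
      P = WPSpace.mk w u hu ∧ ∀ j, u j ^ m j ∈ S}.Finite := by
  have hfin : {u : Fin (n + 1) → L | ∀ j, u j ^ m j ∈ S}.Finite := by
    simpa [Set.pi] using Set.Finite.pi' fun j => finite_setOf_pow_mem (hm j) hS
  have hsub := hfin.preimage (f := (Subtype.val : {u : Fin (n + 1) → L // u ≠ 0} → _))
    Subtype.val_injective.injOn
  refine (hsub.image (Quotient.mk (orbitSetoid L w))).subset ?_
  rintro P ⟨u, hu, rfl, h⟩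
  exact ⟨⟨u, hu⟩, h, rfl⟩

/-- Rescaling a point so that its `i`-th coordinate is `1` requires extracting a `w_i`-th root of
`x_i`; this is where passing to an algebraically closed field is needed. -/
theorem exists_mk_eq_mk_pow_complWeight {L : Type*} [Field L] [IsAlgClosed L] {n : ℕ}
    (w : Fin (n + 1) → ℕ+) {x : Fin (n + 1) → L} (hx : x ≠ 0) {i : Fin (n + 1)} (hi : x i ≠ 0) :
    ∃ (u : Fin (n + 1) → L) (hu : u ≠ 0), WPSpace.mk w x hx = WPSpace.mk w u hu ∧
      ∀ j, u j ^ complWeight w j = x j ^ complWeight w j / x i ^ complWeight w i := by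
  -- Scaling by `t` makes the `i`-th coordinate equal to `1`.
  obtain ⟨t, ht⟩ := IsAlgClosed.exists_pow_nat_eq (x i)⁻¹ (w i).pos
  have ht0 : t ≠ 0 := by
    rintro rfl
    rw [zero_pow (w i).ne_zero] at ht
    exact inv_ne_zero hi ht.symm
  refine ⟨star w (Units.mk0 t ht0) x, star_ne_zero w _ hx, ?_, fun j => ?_⟩
  · exact Quotient.sound ((orbitSetoid L w).symm ⟨Units.mk0 t ht0, rfl⟩)
  · simp only [star, Units.val_mk0]
    rw [mul_pow, ← pow_mul, mul_complWeight, ← mul_complWeight w i, pow_mul, ht, inv_pow,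
      mul_comm, div_eq_mul_inv]

/-- The Northcott property of the weighted height. -/
theorem finite_image_baseChange_setOf_weightedHeight_le {K : Type*} [Field K] [NumberField K]
    (L : Type*) [Field L] [Algebra K L] [IsAlgClosed L] {n : ℕ} (w : Fin (n + 1) → ℕ+) (c : ℝ) :
    (WPSpace.baseChange L '' {p : WPSpace K w | weightedHeight p ≤ c}).Finite := by
  have hS := (NumberField.finite_setOfPred_mulHeight₁_le K (c ^ ∏ k, (w k : ℕ))).image
    (algebraMap K L)
  refine (finite_setOf_mk_pow_mem w (complWeight_ne_zero w) hS).subset ?_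
  rintro _ ⟨p, hp, rfl⟩
  induction p using Quotient.inductionOn with
  | _ x =>
  obtain ⟨x, hx⟩ := x
  obtain ⟨i, hi⟩ := Function.ne_iff.mp hx
  have hi' : algebraMap K L (x i) ≠ 0 := by simpa using hi
  obtain ⟨u, hu, hmk, hpow⟩ := exists_mk_eq_mk_pow_complWeight w
    (x := fun j => algebraMap K L (x j)) (Function.ne_iff.mpr ⟨i, hi'⟩) hi'
  refine ⟨u, hu, hmk, fun j => ⟨x j ^ complWeight w j / x i ^ complWeight w i, ?_, ?_⟩⟩
  · exact (mulHeight₁_div_le_heightOfTuple_pow w hx i j).trans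
      (pow_le_pow_left₀ (heightOfTuple_nonneg w x) hp _)
  · simp [hpow j]

end WeightedProj

theorem mainTheorem11 (K : Type*) [Field K] [NumberField K] (n : ℕ) (w : Fin (n + 1) → ℕ+)
    (c₀ : ℝ) :
    (WeightedProj.WPSpace.baseChange (AlgebraicClosure K) ''
      {p : WeightedProj.WPSpace K w |
        (∃ M : IntermediateField ℚ (AlgebraicClosure K),
          WeightedProj.IsFieldOfDefinition
              (WeightedProj.WPSpace.baseChange (AlgebraicClosure K) p) M ∧
            M ≤ (IsScalarTower.toAlgHom ℚ K (AlgebraicClosure K)).fieldRange) ∧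
        WeightedProj.weightedHeight p ≤ c₀}).Finite := by
  exact (WeightedProj.finite_image_baseChange_setOf_weightedHeight_le (AlgebraicClosure K) w
    c₀).subset (Set.image_mono fun _ hp => hp.2)
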